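/- Let $\mathcal H$ be a complex Hilbert space and let $\mathfrak A\subseteq\mathcal B(\mathcal H)$ be a von Neumann algebra that is a factor (its center consists of the scalar multiples of the identity $I$) and that is not of type I$_2$, i.e. $\mathfrak A\not\cong M_2(\mathbb C)$. Assume that $\mathfrak A$ is semifinite, and let $\tau$ be a faithful normal semifinite tracial weight on $\mathfrak A$; denote also by $\tau$ its linear extension to the linear span of the positive elements of finite trace. For $c\in(0,\tau(I)/2)$ (with $\tau(I)/2=\infty$ if $\tau(I)=\infty$) let $$\mathscr P_c=\{P\in\mathfrak A:\ P=P^*=P^2,\ \tau(P)=c\}.$$ Let $\varphi:\mathscr P_c\to\mathscr P_c$ be a map (not assumed injective, surjective or continuous) that preserves the transition probability: $$\tau(\varphi(P)\varphi(Q))=\tau(PQ)\qquad\text{for all }P,Q\in\mathscr P_c .$$ If $P,Q\in\mathscr P_c$ satisfy $PQ=QP$, then $\varphi(P)\varphi(Q)=\varphi(Q)\varphi(P)$. -/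

import Mathlib

open scoped ENNReal NNReal

section SemifiniteFactors

variable {H : Type*} [NormedAddCommGroup H] [InnerProductSpace ℂ H] [CompleteSpace H]

namespace VonNeumannAlgebra

/-- A factor: a von Neumann algebra whose center consists of the scalar multiples of the
identity. -/
def IsFactor (A : VonNeumannAlgebra H) : Prop :=
  ∀ z ∈ A, z ∈ A.commutant → ∃ l : ℂ, z = l • (1 : H →L[ℂ] H)

/-- A factor of type I₂: one that is `*`-isomorphic to the algebra of complex 2 × 2 matrices. -/
def IsTypeITwo (A : VonNeumannAlgebra H) : Prop :=
  Nonempty (A.toStarSubalgebra ≃⋆ₐ[ℂ] Matrix (Fin 2) (Fin 2) ℂ)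

/-- `τ` is a faithful normal semifinite tracial weight on `A`. Only the values of `τ` at the
positive elements of `A` matter; elsewhere `τ` is arbitrary and never used. The order is the
Loewner order on operators. -/
structure IsFNSTrace (A : VonNeumannAlgebra H) (τ : (H →L[ℂ] H) → ℝ≥0∞) : Prop where
  /-- additivity on the positive cone -/
  add : ∀ x ∈ A, ∀ y ∈ A, 0 ≤ x → 0 ≤ y → τ (x + y) = τ x + τ y
  /-- positive homogeneity, with the convention `0 * ∞ = 0` -/
  smul : ∀ (r : ℝ≥0), ∀ x ∈ A, 0 ≤ x → τ (((r : ℝ) : ℂ) • x) = (r : ℝ≥0∞) * τ x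
  /-- the trace property -/
  tracial : ∀ x ∈ A, τ (star x * x) = τ (x * star x)
  /-- faithfulness -/
  faithful : ∀ x ∈ A, 0 ≤ x → τ x = 0 → x = 0
  /-- normality: `τ` preserves suprema of bounded upward directed families of positive elements -/
  normal : ∀ D : Set (H →L[ℂ] H), D.Nonempty → DirectedOn (· ≤ ·) D →
    (∀ y ∈ D, y ∈ A ∧ 0 ≤ y) → ∀ x ∈ A, IsLUB D x → τ x = ⨆ y ∈ D, τ y
  /-- semifiniteness -/
  semifinite : ∀ x ∈ A, 0 ≤ x → x ≠ 0 → ∃ y ∈ A, 0 ≤ y ∧ y ≤ x ∧ y ≠ 0 ∧ τ y < ∞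

/-- `x` is a positive element of `A` of finite trace. -/
def IsFinitePos (A : VonNeumannAlgebra H) (τ : (H →L[ℂ] H) → ℝ≥0∞) (x : H →L[ℂ] H) : Prop :=
  x ∈ A ∧ 0 ≤ x ∧ τ x < ∞

/-- `x` lies in the linear span of the positive elements of `A` of finite trace (the definition
ideal of `τ`), and `t` is the value at `x` of the linear extension of `τ` to this span:
`x = (a - b) + i (c - d)` with `a, b, c, d` positive of finite trace, and
`t = (τ a - τ b) + i (τ c - τ d)`. -/
def HasTrace (A : VonNeumannAlgebra H) (τ : (H →L[ℂ] H) → ℝ≥0∞) (x : H →L[ℂ] H) (t : ℂ) :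
    Prop :=
  ∃ a b c d : H →L[ℂ] H,
    A.IsFinitePos τ a ∧ A.IsFinitePos τ b ∧ A.IsFinitePos τ c ∧ A.IsFinitePos τ d ∧
    x = (a - b) + Complex.I • (c - d) ∧
    t = (((τ a).toReal - (τ b).toReal : ℝ) : ℂ) +
      Complex.I * (((τ c).toReal - (τ d).toReal : ℝ) : ℂ)

open Classical in
/-- The linear extension of the tracial weight `τ` to its definition ideal, that is, to the linear
span of the positive elements of `A` of finite trace (and `0` outside it). It is well defined by
`HasTrace.unique`, and products of projections of finite trace are in its domain by
`hasTrace_mul`. -/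
noncomputable def traceExt (A : VonNeumannAlgebra H) (τ : (H →L[ℂ] H) → ℝ≥0∞)
    (x : H →L[ℂ] H) : ℂ :=
  if h : ∃ t, A.HasTrace τ x t then h.choose else 0

/-- The Grassmann space of all projections in `A` of trace `c`. -/
def Grassmann (A : VonNeumannAlgebra H) (τ : (H →L[ℂ] H) → ℝ≥0∞) (c : ℝ≥0∞) :
    Set (H →L[ℂ] H) :=
  {P | P ∈ A ∧ IsStarProjection P ∧ τ P = c}

/-- `φ` preserves the transition probability: `τ (φ P * φ Q) = τ (P * Q)` for all `P`, `Q`. -/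
def PreservesTransitionProbability (A : VonNeumannAlgebra H) (τ : (H →L[ℂ] H) → ℝ≥0∞)
    {c : ℝ≥0∞} (φ : A.Grassmann τ c → A.Grassmann τ c) : Prop :=
  ∀ P Q : A.Grassmann τ c,
    A.traceExt τ ((φ P : H →L[ℂ] H) * (φ Q : H →L[ℂ] H)) =
      A.traceExt τ ((P : H →L[ℂ] H) * (Q : H →L[ℂ] H))

variable {A : VonNeumannAlgebra H} {τ : (H →L[ℂ] H) → ℝ≥0∞}

theorem toReal_sub_eq (hτ : A.IsFNSTrace τ) {a b c d : H →L[ℂ] H}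
    (ha : A.IsFinitePos τ a) (hb : A.IsFinitePos τ b) (hc : A.IsFinitePos τ c)
    (hd : A.IsFinitePos τ d) (h : a - b = c - d) :
    (τ a).toReal - (τ b).toReal = (τ c).toReal - (τ d).toReal := by
  have h1 : a + d = c + b := by
    rw [← sub_eq_zero] at h ⊢
    rw [← h]; abel
  have h2 := congrArg τ h1
  rw [hτ.add a ha.1 d hd.1 ha.2.1 hd.2.1, hτ.add c hc.1 b hb.1 hc.2.1 hb.2.1] at h2
  have h3 := congrArg ENNReal.toReal h2
  rw [ENNReal.toReal_add ha.2.2.ne hd.2.2.ne, ENNReal.toReal_add hc.2.2.ne hb.2.2.ne] at h3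
  linarith

/-- The value of the linear extension of `τ` does not depend on the decomposition. -/
theorem HasTrace.unique (hτ : A.IsFNSTrace τ) {x : H →L[ℂ] H} {s t : ℂ}
    (hs : A.HasTrace τ x s) (ht : A.HasTrace τ x t) : s = t := by
  obtain ⟨a, b, c, d, ha, hb, hc, hd, hx, rfl⟩ := hs
  obtain ⟨a', b', c', d', ha', hb', hc', hd', hx', rfl⟩ := ht
  have sa : ∀ {y : H →L[ℂ] H}, A.IsFinitePos τ y → star y = y :=
    fun hy => (IsSelfAdjoint.of_nonneg hy.2.1).star_eq
  have e1 : (a - b) + Complex.I • (c - d) = (a' - b') + Complex.I • (c' - d') := hx ▸ hx'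
  have e2 : (a - b) - Complex.I • (c - d) = (a' - b') - Complex.I • (c' - d') := by
    have h := congrArg star e1
    simp only [star_add, star_sub, star_smul, sa ha, sa hb, sa hc, sa hd, sa ha', sa hb', sa hc',
      sa hd', Complex.star_def, Complex.conj_I, neg_smul] at h
    rwa [← sub_eq_add_neg, ← sub_eq_add_neg] at h
  have r1 : a - b = a' - b' := by
    have h2 : (2 : ℂ) • (a - b) = (2 : ℂ) • (a' - b') := by
      rw [two_smul, two_smul]
      calc (a - b) + (a - b)
          = ((a - b) + Complex.I • (c - d)) + ((a - b) - Complex.I • (c - d)) := by abel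
        _ = _ := by rw [e1, e2]; abel
    exact smul_right_injective _ (two_ne_zero' ℂ) h2
  have r2 : c - d = c' - d' := by
    rw [r1] at e1
    exact smul_right_injective _ Complex.I_ne_zero (add_left_cancel e1)
  rw [toReal_sub_eq hτ ha hb ha' hb' r1, toReal_sub_eq hτ hc hd hc' hd' r2]

theorem HasTrace.traceExt_eq (hτ : A.IsFNSTrace τ) {x : H →L[ℂ] H} {t : ℂ}
    (h : A.HasTrace τ x t) : A.traceExt τ x = t := by
  have h' : ∃ t, A.HasTrace τ x t := ⟨t, h⟩
  rw [traceExt, dif_pos h']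
  exact h'.choose_spec.unique hτ h

theorem polar_finite (hτ : A.IsFNSTrace τ) {P Q : H →L[ℂ] H} (hP : P ∈ A) (hQ : Q ∈ A)
    (pP : IsStarProjection P) (pQ : IsStarProjection Q) (fP : τ P < ∞) (fQ : τ Q < ∞)
    (w : ℂ) (hw : star w * w = 1) :
    A.IsFinitePos τ (star ((1 / 2 : ℂ) • (Q + w • P)) * ((1 / 2 : ℂ) • (Q + w • P))) := by
  have mem : ∀ v : ℂ, (1 / 2 : ℂ) • (Q + v • P) ∈ A := fun v =>
    A.toStarSubalgebra.smul_mem (add_mem hQ (A.toStarSubalgebra.smul_mem hP v)) _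
  have mem' : ∀ v : ℂ,
      star ((1 / 2 : ℂ) • (Q + v • P)) * ((1 / 2 : ℂ) • (Q + v • P)) ∈ A := fun v =>
    mul_mem (star_mem (mem v)) (mem v)
  have key : star ((1 / 2 : ℂ) • (Q + w • P)) * ((1 / 2 : ℂ) • (Q + w • P)) +
      star ((1 / 2 : ℂ) • (Q + (-w) • P)) * ((1 / 2 : ℂ) • (Q + (-w) • P)) =
      (((1 / 2 : ℝ≥0) : ℝ) : ℂ) • (P + Q) := by
    have iP := pP.isIdempotentElem.eq
    have iQ := pQ.isIdempotentElem.eq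
    have sP := pP.isSelfAdjoint.star_eq
    have sQ := pQ.isSelfAdjoint.star_eq
    have hw' : w * star w = 1 := by rw [mul_comm]; exact hw
    simp only [star_smul, star_add, sP, sQ, smul_mul_assoc, mul_smul_comm, add_mul, mul_add,
      iP, iQ, smul_add, smul_smul, star_neg, neg_smul, smul_neg, mul_neg, neg_mul]
    match_scalars
    all_goals
      have hc : (starRingEnd ℂ) w * w = 1 := hw
      simp
      try first
        | ring1
        | linear_combination (1 / 2 : ℂ) * hc
  refine ⟨mem' w, star_mul_self_nonneg _, ?_⟩
  have h := congrArg τ key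
  rw [hτ.add _ (mem' w) _ (mem' (-w)) (star_mul_self_nonneg _) (star_mul_self_nonneg _),
    hτ.smul _ _ (add_mem hP hQ) (add_nonneg pP.nonneg pQ.nonneg),
    hτ.add _ hP _ hQ pP.nonneg pQ.nonneg] at h
  refine lt_of_le_of_lt le_self_add (h.trans_lt ?_)
  exact ENNReal.mul_lt_top ENNReal.coe_lt_top (ENNReal.add_lt_top.2 ⟨fP, fQ⟩)

/-- The product of two projections of finite trace lies in the definition ideal of `τ`. -/
theorem hasTrace_mul (hτ : A.IsFNSTrace τ) {P Q : H →L[ℂ] H} (hP : P ∈ A) (hQ : Q ∈ A)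
    (pP : IsStarProjection P) (pQ : IsStarProjection Q) (fP : τ P < ∞) (fQ : τ Q < ∞) :
    ∃ t, A.HasTrace τ (P * Q) t := by
  have F := polar_finite hτ hP hQ pP pQ fP fQ
  refine ⟨_, _, _, _, _, F 1 (by simp), F (-1) (by simp), F Complex.I (by simp),
    F (-Complex.I) (by simp), ?_, rfl⟩
  have iP := pP.isIdempotentElem.eq
  have iQ := pQ.isIdempotentElem.eq
  have sP := pP.isSelfAdjoint.star_eq
  have sQ := pQ.isSelfAdjoint.star_eq
  simp only [star_smul, star_add, sP, sQ, smul_mul_assoc, mul_smul_comm, add_mul, mul_add,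
    iP, iQ, smul_add, smul_smul, star_neg, neg_smul, smul_neg, mul_neg, neg_mul, smul_sub]
  match_scalars <;> (simp; try (ring_nf; try (simp; try ring)))

end VonNeumannAlgebra

end SemifiniteFactors

/-!
The map `φ` preserves real-linear relations among projections: for a real linear combination
`X = ∑ rᵢ Pᵢ`, the number `τ (X * X)` is determined by the transition probabilities, and `τ` is
faithful, so `∑ rᵢ Pᵢ = 0` forces `∑ rᵢ φ(Pᵢ) = 0` (`sum_smul_eq_zero`). It also preserves
orthogonality, since `P Q = 0` exactly when `τ (P Q) = 0` (`mul_eq_zero`).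

Commuting `P` and `Q` have the form `P = E + G`, `Q = F + G` with `E`, `F`, `G` orthogonal and
`τ E = τ F`. Suppose first that `2 c + τ E ≤ τ 1`. Then there are `K` and `G'`, orthogonal to each
other and to `E`, `F`, `G`, with `τ K = τ E` and `τ G' = τ G`. Let `p`, `q`, `t` be the images of
`E + G`, `F + G`, `K + G`. As `p - q = φ(E + G') - φ(F + G')`, and both `E + G'` and `F + G'` are
orthogonal to `K + G`, it follows that `(p - q) t = 0`. By symmetry `(p - t) q = 0` and
`(q - t) p = 0`, and with adjoints `p q = t q = t p = q p` (`commute_of_orthogonal`,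
`commute_exchange_of_small`).

In general `c < τ 1 / 2` leaves a non-zero projection `W` with `2 c + τ W = τ 1`. Copies of `W` are
split off from `E` and `F` simultaneously until what remains is small. When `E = E₁ + E₂` and
`F = F₁ + F₂`, the relation `P - (P - E₁ + F₁) = (P - E₂ + F₂) - Q` carries over to the images, and
`φ(P)` commutes with the images of both intermediate projections, hence with `φ(Q)`
(`commute_exchange`).

The projections `K`, `G'`, `W` and the copies of `W` come from the comparison theorem for
projections in a factor (`IsFactor.comparison`). It is proved by applying Zorn's lemma to partially
defined isometries that commute with the commutant. These extend to partial isometries in the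
algebra (`IsEquivariantIsometry.exists_extension`). A maximal one exhausts one of the two
projections, because non-zero projections in a factor are connected by a non-zero element, whose
polar part is a partial isometry.
-/

section FactorPreservers

open scoped InnerProductSpace

variable {H : Type*} [NormedAddCommGroup H] [InnerProductSpace ℂ H] [CompleteSpace H]

/-! ### Projections and partial isometries on a Hilbert space -/

theorem mul_eq_zero_of_isStarProjection {p q : H →L[ℂ] H} (hp : IsStarProjection p)
    (hq : IsStarProjection q) (h : p * q = 0) : q * p = 0 := by
  simpa only [star_mul, hp.isSelfAdjoint.star_eq, hq.isSelfAdjoint.star_eq, star_zero] using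
    congrArg star h

/-- An operator whose adjoint composes with it to a projection `p` is supported on `p`. -/
theorem mul_eq_self_of_star_mul_self {p v : H →L[ℂ] H} (hp : IsStarProjection p)
    (hv : star v * v = p) : v * p = v := by
  have h : star (v * p - v) * (v * p - v) = 0 := by
    have e : star (v * p - v) * (v * p - v) = (p - 1) * (star v * v) * (p - 1) := by
      simp only [star_sub, star_mul, hp.isSelfAdjoint.star_eq]
      noncomm_ring
    rw [e, hv, sub_mul, hp.isIdempotentElem.eq, one_mul, sub_self, zero_mul]
  exact sub_eq_zero.1 (CStarRing.star_mul_self_eq_zero_iff _ |>.1 h)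

theorem isStarProjection_mul_star {p v : H →L[ℂ] H} (hp : IsStarProjection p)
    (hv : star v * v = p) : IsStarProjection (v * star v) := by
  refine ⟨?_, by simp [isSelfAdjoint_iff]⟩
  have : v * star v * (v * star v) = v * (star v * v) * star v := by noncomm_ring
  rw [IsIdempotentElem, this, hv, mul_eq_self_of_star_mul_self hp hv]

/-- Conjugating by a partial isometry with initial projection `p` carries a subprojection of `p` to
a projection. -/
theorem isStarProjection_conj {p e v : H →L[ℂ] H} (he : IsStarProjection e)
    (hv : star v * v = p) (hpe : p * e = e) : IsStarProjection (v * e * star v) := by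
  refine ⟨?_, ?_⟩
  · have : v * e * star v * (v * e * star v) = v * (e * (star v * v * e)) * star v := by
      noncomm_ring
    rw [IsIdempotentElem, this, hv, hpe, he.isIdempotentElem.eq]
  · rw [IsSelfAdjoint, star_mul, star_mul, star_star, he.isSelfAdjoint.star_eq, mul_assoc]

theorem norm_apply_sq_eq_inner (v : H →L[ℂ] H) (x : H) :
    ‖v x‖ ^ 2 = (⟪(star v * v) x, x⟫_ℂ).re := by
  rw [ContinuousLinearMap.star_eq_adjoint]
  exact v.apply_norm_sq_eq_inner_adjoint_left x

theorem mul_starProjection_closure_eq_zero {M : Submodule ℂ H} {w : H →L[ℂ] H}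
    (hw : ∀ x ∈ M, w x = 0) : w * M.topologicalClosure.starProjection = 0 := by
  ext h
  exact Submodule.topologicalClosure_minimal M (t := w.ker) hw w.isClosed_ker
    (Submodule.starProjection_apply_mem _ h)

namespace VonNeumannAlgebra

/-! ### Isometries commuting with the commutant -/

/-- A partially defined isometry of `H` (its domain a subspace, not assumed closed) that commutes
with the commutant of `A`. These are the restrictions of partial isometries in `A` to subspaces
that are invariant under the commutant. -/
structure IsEquivariantIsometry (A : VonNeumannAlgebra H) (f : H →ₗ.[ℂ] H) : Prop where
  /-- `f` preserves norms -/
  norm_map : ∀ x : f.domain, ‖f x‖ = ‖(x : H)‖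
  /-- the domain is invariant under the commutant, and `f` commutes with it -/
  map_commutant : ∀ y ∈ A.commutant, ∀ x : f.domain,
    ∃ z : f.domain, (z : H) = y x ∧ f z = y (f x)

variable {A : VonNeumannAlgebra H}

theorem mem_of_commute_commutant {v : H →L[ℂ] H} (h : ∀ y ∈ A.commutant, y * v = v * y) :
    v ∈ A := by
  rw [← commutant_commutant A, mem_commutant_iff]
  exact h

/-- An equivariant isometry extends to a partial isometry in `A`, whose initial space is the
closure of the domain. -/
theorem IsEquivariantIsometry.exists_extension {f : H →ₗ.[ℂ] H} (hf : A.IsEquivariantIsometry f) :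
    ∃ v ∈ A, (∀ x : f.domain, v x = f x) ∧
      star v * v = f.domain.topologicalClosure.starProjection := by
  set K : Submodule ℂ H := f.domain.topologicalClosure with hK
  have hle : f.domain ≤ K := f.domain.le_topologicalClosure
  have : CompleteSpace K := f.domain.isClosed_topologicalClosure.completeSpace_coe
  let g : f.domain →ₗᵢ[ℂ] H := ⟨f.toFun, hf.norm_map⟩
  let e : f.domain →ₗᵢ[ℂ] K := ⟨Submodule.inclusion hle, fun _ => rfl⟩
  have hd : DenseRange e := by
    have := (denseRange_inclusion_iff (s := (f.domain : Set H)) (t := (K : Set H)) hle).2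
      (by rw [hK, Submodule.topologicalClosure_coe])
    exact this
  have hu : IsUniformInducing e := e.isometry.isUniformInducing
  -- the extension of `f` to the closure of its domain by continuity, again equivariant
  let w : K →L[ℂ] H := g.toContinuousLinearMap.extend e.toContinuousLinearMap
  have hw : ∀ x : f.domain, w (e x) = f x := fun x =>
    ContinuousLinearMap.extend_eq g.toContinuousLinearMap
      (e := e.toContinuousLinearMap) hd hu x
  have hwn : ∀ x : K, ‖w x‖ = ‖x‖ := fun x =>
    hd.induction_on (p := fun x => ‖w x‖ = ‖x‖) x
      (isClosed_eq (by fun_prop) (by fun_prop))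
      (fun a => by rw [hw, hf.norm_map]; rfl)
  let W : K →ₗᵢ[ℂ] H := ⟨w.toLinearMap, hwn⟩
  have key : ∀ (y : H →L[ℂ] H), y ∈ A.commutant → ∀ k : K, ∃ z : K, (z : H) = y k ∧
      w z = y (w k) := by
    intro y hy k
    have hyK : ∀ k : K, y k ∈ K := fun k =>
      hd.induction_on (p := fun k : K => y k ∈ K) k
        (f.domain.isClosed_topologicalClosure.preimage (by fun_prop))
        (fun a => by
          obtain ⟨z, hz, -⟩ := hf.map_commutant y hy a
          exact hle (show y a ∈ f.domain from hz ▸ z.2))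
    let Y : K →L[ℂ] K := (y.comp K.subtypeL).codRestrict K hyK
    refine ⟨Y k, rfl, hd.induction_on (p := fun k : K => w (Y k) = y (w k)) k
      (isClosed_eq (by fun_prop) (by fun_prop)) (fun a => ?_)⟩
    obtain ⟨z, hz, hz'⟩ := hf.map_commutant y hy a
    rw [hw, ← hz', ← hw z]
    congr 1
    exact Subtype.ext hz.symm
  have hPy : ∀ y ∈ A.commutant, y * K.starProjection = K.starProjection * y := by
    have : K.starProjection ∈ A := by
      rw [IsStarProjection.mem_iff isStarProjection_starProjection]
      intro y hy x hx
      rw [Submodule.range_starProjection] at hx ⊢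
      obtain ⟨z, hz, -⟩ := key y hy ⟨x, hx⟩
      exact Submodule.mem_comap.2 (show y x ∈ K from hz ▸ z.2)
    intro y hy
    exact (mem_commutant_iff.1 hy _ this).symm
  let v : H →L[ℂ] H := w.comp K.orthogonalProjectionOnto
  refine ⟨v, mem_of_commute_commutant fun y hy => ?_, fun x => ?_, ?_⟩
  · ext x
    obtain ⟨z, hz, hz'⟩ := key y hy (K.orthogonalProjectionOnto x)
    have h1 : z = K.orthogonalProjectionOnto (y x) := by
      apply Subtype.ext
      rw [hz]
      exact congrArg (fun T : H →L[ℂ] H => T x) (hPy y hy)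
    exact hz'.symm.trans (congrArg w h1)
  · change w (K.orthogonalProjectionOnto x) = f x
    rw [← hw x]
    congr 1
    exact Submodule.orthogonalProjectionOnto_mem_subspace_eq_self (K := K) (e x)
  · ext x
    refine ext_inner_right ℂ fun y => ?_
    rw [ContinuousLinearMap.star_eq_adjoint, mul_apply_eq_comp,
      ContinuousLinearMap.adjoint_inner_left]
    change ⟪W (K.orthogonalProjectionOnto x), W (K.orthogonalProjectionOnto y)⟫_ℂ = _
    rw [W.inner_map_map, Submodule.coe_inner]
    change ⟪K.starProjection x, K.starProjection y⟫_ℂ = _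
    rw [← Submodule.inner_starProjection_left_eq_right]
    congr 1
    exact Submodule.starProjection_eq_self_iff.2 (Submodule.starProjection_apply_mem K x)

/-- Polar decomposition: an operator in `A` that maps into the range of `q` and vanishes off the
range of `p` yields a non-zero partial isometry in `A` with the same property. -/
theorem exists_partialIsometry_of_ne_zero {x p q : H →L[ℂ] H} (hx : x ∈ A) (hx0 : x ≠ 0)
    (hxp : x * p = x) (hqx : q * x = x) :
    ∃ u ∈ A, u ≠ 0 ∧ IsStarProjection (star u * u) ∧ u * p = u ∧ q * u = u := by
  set a := CFC.abs x with ha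
  have haa : star a * a = star x * x := by
    rw [(IsSelfAdjoint.of_nonneg (CFC.abs_nonneg x)).star_eq, CFC.abs_mul_abs]
  have hn : ∀ h, ‖a h‖ = ‖x h‖ := fun h => by
    have := norm_apply_sq_eq_inner a h
    rw [haa, ← norm_apply_sq_eq_inner] at this
    exact (sq_eq_sq₀ (norm_nonneg _) (norm_nonneg _)).1 this
  have hxa : ∀ h h', a h = a h' → x h = x h' := fun h h' e => by
    rw [← sub_eq_zero, ← map_sub, ← norm_eq_zero, ← hn, map_sub, e, sub_self, norm_zero]
  have hay : ∀ y ∈ A.commutant, y * a = a * y := fun y hy => by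
    have h1 : Commute x y := mem_commutant_iff.1 hy x hx
    have h2 : Commute x (star y) := mem_commutant_iff.1 (star_mem hy) x hx
    exact (h1.cfcAbs_left h2).symm
  -- `f` sends `|x| h` to `x h`; this does not depend on the choice of `h`, by `hxa`
  let c : a.range → H := fun m => m.2.choose
  have hc : ∀ m : a.range, a (c m) = m := fun m => m.2.choose_spec
  let f : H →ₗ.[ℂ] H :=
    { domain := a.range
      toFun :=
        { toFun := fun m => x (c m)
          map_add' := fun m n => by
            rw [← map_add]
            exact hxa _ _ (by rw [map_add, hc, hc, hc]; rfl)
          map_smul' := fun r m => by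
            rw [RingHom.id_apply, ← map_smul]
            exact hxa _ _ (by rw [map_smul, hc, hc]; rfl) } }
  have hfa : ∀ (h : H) (m : f.domain), (m : H) = a h → f m = x h := fun h m e =>
    hxa _ _ ((hc m).trans e)
  have hf : A.IsEquivariantIsometry f := by
    refine ⟨fun m => ?_, fun y hy m => ?_⟩
    · change ‖x (c m)‖ = _
      rw [← hn, hc]
    · have e : a (y (c m)) = y m := by
        rw [← hc m]
        exact (congrArg (fun T : H →L[ℂ] H => T (c m)) (hay y hy)).symm
      refine ⟨⟨y m, ⟨y (c m), e⟩⟩, rfl, ?_⟩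
      rw [hfa (y (c m)) _ e.symm]
      exact congrArg (fun T : H →L[ℂ] H => T (c m)) (mem_commutant_iff.1 hy x hx)
  obtain ⟨u, hu, huf, hus⟩ := hf.exists_extension
  have hux : u * a = x := by
    ext h
    exact (huf ⟨a h, ⟨h, rfl⟩⟩).trans (hfa h _ rfl)
  have hPr : IsStarProjection (star u * u) := hus ▸ isStarProjection_starProjection
  have huu : u * (star u * u) = u := mul_eq_self_of_star_mul_self hPr rfl
  -- an operator that vanishes on the range of `a` vanishes on the initial space of `u`
  have vanish : ∀ w : H →L[ℂ] H, w * a = 0 → w * (star u * u) = 0 := fun w hw => by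
    rw [hus]
    refine mul_starProjection_closure_eq_zero ?_
    rintro _ ⟨h, rfl⟩
    exact congrArg (fun T : H →L[ℂ] H => T h) hw
  refine ⟨u, hu, ?_, hPr, ?_, ?_⟩
  · rintro rfl
    exact hx0 (by rw [← hux, zero_mul])
  · have hap : a * p = a := by
      ext h
      rw [← sub_eq_zero, mul_apply_eq_comp, ← map_sub, ← norm_eq_zero, hn, map_sub,
        ← mul_apply_eq_comp, hxp, sub_self, norm_zero]
    have hpa : (star p - 1) * a = 0 := by
      have := congrArg star hap
      rw [star_mul, (IsSelfAdjoint.of_nonneg (CFC.abs_nonneg x)).star_eq] at this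
      rw [sub_mul, this, one_mul, sub_self]
    have h := congrArg star (vanish _ hpa)
    rw [star_mul, hPr.isSelfAdjoint.star_eq, star_zero, star_sub, star_star, star_one, mul_sub,
      mul_one, sub_eq_zero] at h
    calc u * p = u * (star u * u * p) := by rw [← mul_assoc, huu]
      _ = u := by rw [h, huu]
  · have h := vanish (q * u - u) (by rw [sub_mul, mul_assoc, hux, hqx, sub_self])
    rw [sub_mul, mul_assoc, huu, sub_eq_zero] at h
    exact h

/-- In a factor, two non-zero projections are never centrally disjoint. -/
theorem IsFactor.exists_mul_mul_ne_zero (hA : A.IsFactor) {p q : H →L[ℂ] H}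
    (hqA : q ∈ A) (hp0 : p ≠ 0) (hq0 : q ≠ 0) : ∃ y ∈ A, q * y * p ≠ 0 := by
  by_contra! hcon
  -- the vectors annihilated by `q A`: a closed subspace invariant under `A` and its commutant
  let N : Submodule ℂ H := ⨅ y : A, (q * (y : H →L[ℂ] H)).ker
  have hN : ∀ h, h ∈ N ↔ ∀ y ∈ A, q (y h) = 0 := fun h => by
    simp [N, Submodule.mem_iInf]
  have hcl : IsClosed (N : Set H) := by
    simp only [N, Submodule.coe_iInf]
    exact isClosed_iInter fun y => ContinuousLinearMap.isClosed_ker _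
  have : CompleteSpace N := hcl.completeSpace_coe
  have hz : IsStarProjection N.starProjection := isStarProjection_starProjection
  have hzA : N.starProjection ∈ A := by
    rw [IsStarProjection.mem_iff hz]
    intro y hy x hx
    rw [Submodule.range_starProjection] at hx ⊢
    refine (hN _).2 fun a ha => ?_
    have h1 := congrArg (fun T : H →L[ℂ] H => T x) (mem_commutant_iff.1 hy _ (mul_mem hqA ha))
    have h2 : q (a (y x)) = y (q (a x)) := h1
    have h3 : q (a x) = 0 := (hN x).1 hx a ha
    exact h2.trans (by rw [h3, map_zero])
  have hzA' : N.starProjection ∈ A.commutant := by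
    rw [IsStarProjection.mem_iff hz, commutant_commutant]
    intro y hy x hx
    rw [Submodule.range_starProjection] at hx ⊢
    exact (hN _).2 fun a ha => (hN x).1 hx (a * y) (mul_mem ha hy)
  have hzp : N.starProjection * p = p := by
    ext h
    refine Submodule.starProjection_eq_self_iff.2 ((hN _).2 fun a ha => ?_)
    exact congrArg (fun T : H →L[ℂ] H => T h) (hcon a ha)
  obtain ⟨l, hl⟩ := hA _ hzA hzA'
  have hl0 : l ≠ 0 := by
    rintro rfl
    rw [hl, zero_smul, zero_mul] at hzp
    exact hp0 hzp.symm
  refine hq0 (ContinuousLinearMap.ext fun h => ?_)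
  have hmem : l • h ∈ N := by
    have := Submodule.starProjection_apply_mem N h
    rwa [hl] at this
  have hh : h ∈ N := by simpa [hl0] using N.smul_mem l⁻¹ hmem
  exact (hN h).1 hh 1 (one_mem A)

/-! ### Comparison of projections in a factor -/

/-- The union of a non-empty chain of equivariant isometries is an equivariant isometry. -/
theorem IsEquivariantIsometry.sSup {c : Set (H →ₗ.[ℂ] H)} (hne : c.Nonempty)
    (hc : DirectedOn (· ≤ ·) c) (h : ∀ f ∈ c, A.IsEquivariantIsometry f) :
    A.IsEquivariantIsometry (LinearPMap.sSup c hc) := by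
  refine ⟨fun x => ?_, fun y hy x => ?_⟩ <;>
    obtain ⟨f, hf, hx⟩ := (LinearPMap.mem_domain_sSup_iff hne hc).1 x.2
  · rw [← (h f hf).norm_map ⟨x, hx⟩, ← LinearPMap.sSup_apply hc hf]
  · obtain ⟨z, hz, hz'⟩ := (h f hf).map_commutant y hy ⟨x, hx⟩
    refine ⟨⟨z, (LinearPMap.le_sSup hc hf).1 z.2⟩, hz, ?_⟩
    rw [LinearPMap.sSup_apply hc hf, hz', ← LinearPMap.sSup_apply hc hf]

/-- The comparison theorem: of two projections in a factor, one is equivalent to a subprojection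
of the other. -/
theorem IsFactor.comparison (hA : A.IsFactor) {p q : H →L[ℂ] H} (hpA : p ∈ A) (hqA : q ∈ A)
    (hp : IsStarProjection p) (hq : IsStarProjection q) :
    ∃ v ∈ A, (star v * v = p ∧ q * v = v) ∨ (v * star v = q ∧ v * p = v) := by
  -- the partial isometries from the range of `p` to the range of `q`
  let S : Set (H →ₗ.[ℂ] H) :=
    {f | A.IsEquivariantIsometry f ∧ ∀ x : f.domain, p x = x ∧ q (f x) = f x}
  have hbot : (⊥ : H →ₗ.[ℂ] H) ∈ S := by
    have h0 : ∀ x : (⊥ : H →ₗ.[ℂ] H).domain, (x : H) = 0 := fun x => (Submodule.mem_bot ℂ).1 x.2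
    refine ⟨⟨fun x => ?_, fun y _ x => ⟨0, ?_, ?_⟩⟩, fun x => ⟨?_, ?_⟩⟩
    · rw [h0 x, norm_zero]; exact norm_zero
    · rw [h0 x, map_zero]; rfl
    · exact (map_zero y).symm
    · rw [h0 x, map_zero]
    · exact map_zero q
  obtain ⟨m, -, hm⟩ := zorn_le_nonempty₀ S (fun c hcS hc g hg => by
    have hd := hc.directedOn
    refine ⟨LinearPMap.sSup c hd, ⟨.sSup ⟨g, hg⟩ hd fun f hf => (hcS hf).1, fun x => ?_⟩,
      fun f hf => LinearPMap.le_sSup hd hf⟩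
    obtain ⟨f, hf, hx⟩ := (LinearPMap.mem_domain_sSup_iff ⟨g, hg⟩ hd).1 x.2
    have := (hcS hf).2 ⟨x, hx⟩
    rwa [← LinearPMap.sSup_apply hd hf] at this) ⊥ hbot
  obtain ⟨hmS, hmpq⟩ := hm.prop
  obtain ⟨v, hvA, hvm, hvs⟩ := hmS.exists_extension
  have hv : IsStarProjection (star v * v) := hvs ▸ isStarProjection_starProjection
  have hvv : v * (star v * v) = v := mul_eq_self_of_star_mul_self hv rfl
  have hvv' : star v * v * star v = star v := by
    simpa only [star_mul, star_star] using congrArg star hvv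
  have hvm' : ∀ x : m.domain, (star v * v) x = x := fun x => by
    rw [hvs]
    exact Submodule.starProjection_eq_self_iff.2 (m.domain.le_topologicalClosure x.2)
  have vanish : ∀ w : H →L[ℂ] H, (∀ x : m.domain, w x = 0) → w * (star v * v) = 0 :=
    fun w hw => by
      rw [hvs]
      exact mul_starProjection_closure_eq_zero fun x hx => hw ⟨x, hx⟩
  have hpv : p * (star v * v) = star v * v := by
    have := vanish (p - 1) fun x => sub_eq_zero.2 (hmpq x).1
    rwa [sub_mul, one_mul, sub_eq_zero] at this
  have hvp : star v * v * p = star v * v := by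
    simpa only [star_mul, star_star, hp.isSelfAdjoint.star_eq] using congrArg star hpv
  have hqv : q * v = v := by
    have := vanish (q * v - v) fun x => sub_eq_zero.2 <| by
      change q (v x) = v x
      rw [hvm]
      exact (hmpq x).2
    rwa [sub_mul, mul_assoc, hvv, sub_eq_zero] at this
  have hvq : star v * q = star v := by
    simpa only [star_mul, hq.isSelfAdjoint.star_eq] using congrArg star hqv
  by_cases hp0 : p - star v * v = 0
  · exact ⟨v, hvA, .inl ⟨(sub_eq_zero.1 hp0).symm, hqv⟩⟩
  by_cases hq0 : q - v * star v = 0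
  · refine ⟨v, hvA, .inr ⟨(sub_eq_zero.1 hq0).symm, ?_⟩⟩
    rw [← hvv, mul_assoc, hvp]
  -- otherwise a partial isometry between the complements of the initial and the final space
  -- enlarges the maximal element
  exfalso
  obtain ⟨y, hyA, hy0⟩ := hA.exists_mul_mul_ne_zero
    (sub_mem hqA (mul_mem hvA (star_mem hvA))) hp0 hq0
  have hp' : IsIdempotentElem (p - star v * v) := by
    rw [IsIdempotentElem, mul_sub, sub_mul, sub_mul, hp.isIdempotentElem.eq, hpv, hvp,
      hv.isIdempotentElem.eq]
    abel
  have hq' : IsIdempotentElem (q - v * star v) := by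
    have e1 : q * (v * star v) = v * star v := by rw [← mul_assoc, hqv]
    have e2 : v * star v * q = v * star v := by rw [mul_assoc, hvq]
    have e3 : v * star v * (v * star v) = v * star v := by
      rw [← mul_assoc, mul_assoc v, hvv]
    rw [IsIdempotentElem, mul_sub, sub_mul, sub_mul, hq.isIdempotentElem.eq, e1, e2, e3]
    abel
  obtain ⟨u, huA, hu0, hu, hup, hqu⟩ := exists_partialIsometry_of_ne_zero
    (mul_mem (mul_mem (sub_mem hqA (mul_mem hvA (star_mem hvA))) hyA)
      (sub_mem hpA (mul_mem (star_mem hvA) hvA))) hy0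
    (by rw [mul_assoc, hp'.eq]) (by rw [← mul_assoc, ← mul_assoc, hq'.eq])
  have huv : u * (star v * v) = 0 := by
    rw [← hup, mul_assoc, sub_mul, hpv, hv.isIdempotentElem.eq, sub_self, mul_zero]
  have hvu : star v * u = 0 := by
    rw [← hqu, ← mul_assoc, mul_sub, hvq, ← mul_assoc, hvv', sub_self, zero_mul]
  have huv' : star u * v = 0 := by
    simpa only [star_mul, star_star, star_zero] using congrArg star hvu
  have hvvu : star v * v * star u = 0 := by
    simpa only [star_mul, star_star, star_zero] using congrArg star huv
  have hup' : u * p = u := by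
    rwa [mul_sub, huv, sub_zero] at hup
  have hpu : p * star u = star u := by
    simpa only [star_mul, hp.isSelfAdjoint.star_eq] using congrArg star hup'
  have hqu' : q * u = u := by
    rwa [sub_mul, mul_assoc, hvu, mul_zero, sub_zero] at hqu
  set e := star v * v + star u * u with he
  have hee : star (v + u) * (v + u) = e := by
    rw [star_add, mul_add, add_mul, add_mul, hvu, huv', he]
    abel
  have heA : e ∈ A := add_mem (mul_mem (star_mem hvA) hvA) (mul_mem (star_mem huA) huA)
  -- `v + u`, restricted to the range of the projection `e`
  let g : H →ₗ.[ℂ] H :=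
    { domain := (e - 1).ker
      toFun := (v + u).toLinearMap.domRestrict _ }
  have hge : ∀ x : H, x ∈ g.domain ↔ e x = x := fun x => by
    change (e - 1) x = 0 ↔ _
    rw [sub_apply, sub_eq_zero]
    rfl
  have hgS : g ∈ S := by
    refine ⟨⟨fun x => ?_, fun y hy x => ?_⟩, fun x => ⟨?_, ?_⟩⟩
    · have h := norm_apply_sq_eq_inner (v + u) x
      rw [hee, (hge x).1 x.2, inner_self_eq_norm_sq_to_K] at h
      refine (sq_eq_sq₀ (norm_nonneg _) (norm_nonneg _)).1 (h.trans ?_)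
      norm_cast
    · have h1 : e (y x) = y (e x) :=
        congrArg (fun T : H →L[ℂ] H => T x) (mem_commutant_iff.1 hy e heA)
      refine ⟨⟨y x, (hge _).2 (by rw [h1, (hge x).1 x.2])⟩, rfl, ?_⟩
      exact congrArg (fun T : H →L[ℂ] H => T x) (mem_commutant_iff.1 hy _ (add_mem hvA huA))
    · have h1 : p * e = e := by rw [he, mul_add, hpv, ← mul_assoc, hpu]
      rw [← (hge x).1 x.2, ← mul_apply_eq_comp, h1]
    · have h1 : q * (v + u) = v + u := by rw [mul_add, hqv, hqu']
      exact congrArg (fun T : H →L[ℂ] H => T x) h1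
  have hmg : m ≤ g := by
    have hux : ∀ x : m.domain, u x = 0 := fun x => by
      rw [← hvm' x]
      exact congrArg (fun T : H →L[ℂ] H => T x) huv
    refine ⟨fun x hx => (hge x).2 ?_, ?_⟩
    · rw [he, add_apply, hvm' ⟨x, hx⟩, mul_apply_eq_comp, hux ⟨x, hx⟩,
        map_zero, add_zero]
    · intro x z hxz
      change m x = v z + u z
      rw [← hxz, hux, add_zero, hvm]
  have hgm := hm.le_of_ge hgS hmg
  have hu1 : star u * u = 0 := by
    ext h
    have h1 : (star u * u) h ∈ g.domain := by
      rw [hge, ← mul_apply_eq_comp, he, add_mul, ← mul_assoc, hvvu, zero_mul, zero_add,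
        hu.isIdempotentElem.eq]
    have h2 : (star v * v) ((star u * u) h) = (star u * u) h := hvm' ⟨_, hgm.1 h1⟩
    rw [← h2, ← mul_apply_eq_comp, ← mul_assoc, hvvu, zero_mul]
  exact hu0 (CStarRing.star_mul_self_eq_zero_iff _ |>.1 hu1)

/-! ### Semifinite traces and their linear extension -/

variable {τ : (H →L[ℂ] H) → ℝ≥0∞}

theorem IsFNSTrace.mono (hτ : A.IsFNSTrace τ) {x y : H →L[ℂ] H} (hx : x ∈ A) (hy : y ∈ A)
    (hx0 : 0 ≤ x) (hxy : x ≤ y) : τ x ≤ τ y := by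
  have h := hτ.add x hx (y - x) (sub_mem hy hx) hx0 (sub_nonneg.2 hxy)
  rw [add_sub_cancel] at h
  rw [h]
  exact le_self_add

theorem IsFNSTrace.map_zero (hτ : A.IsFNSTrace τ) : τ 0 = 0 := by
  simpa using hτ.smul 0 0 (zero_mem A) le_rfl

theorem IsFNSTrace.sub_add (hτ : A.IsFNSTrace τ) {p e : H →L[ℂ] H} (hp : p ∈ A) (he : e ∈ A)
    (he0 : 0 ≤ e) (hpe : 0 ≤ p - e) : τ (p - e) + τ e = τ p := by
  rw [← hτ.add _ (sub_mem hp he) _ he hpe he0, sub_add_cancel]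

/-- In a factor, a projection of finite trace is equivalent to a subprojection of any projection
of at least the same trace. -/
theorem IsFNSTrace.exists_partialIsometry (hτ : A.IsFNSTrace τ) (hA : A.IsFactor)
    {p q : H →L[ℂ] H} (hpA : p ∈ A) (hqA : q ∈ A) (hp : IsStarProjection p)
    (hq : IsStarProjection q) (hfin : τ p ≠ ∞) (hle : τ p ≤ τ q) :
    ∃ v ∈ A, star v * v = p ∧ q * v = v := by
  obtain ⟨v, hv, ⟨h1, h2⟩ | ⟨h1, h2⟩⟩ := hA.comparison hpA hqA hp hq
  · exact ⟨v, hv, h1, h2⟩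
  -- here `star v * v ≤ p` has trace `τ q ≥ τ p`, so it is all of `p`
  have hs : star (star v) * star v = q := by rw [star_star, h1]
  have hr : IsStarProjection (star v * v) := by
    simpa only [star_star] using isStarProjection_mul_star hq hs
  have hrp : star v * v * p = star v * v := by rw [mul_assoc, h2]
  have hsub := hr.sub_of_mul_eq_left hp hrp
  have h3 := hτ.sub_add hpA (mul_mem (star_mem hv) hv) (star_mul_self_nonneg v) hsub.nonneg
  rw [hτ.tracial v hv, h1] at h3
  have h4 : τ (p - star v * v) = 0 := by
    have hq' : τ q ≠ ∞ := fun h => hfin (by rw [← h3, h, add_top])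
    refine nonpos_iff_eq_zero.1 ((ENNReal.add_le_add_iff_right hq').1 ?_)
    rw [h3, zero_add]
    exact hle
  have h5 := sub_eq_zero.1 (hτ.faithful _ (sub_mem hpA (mul_mem (star_mem hv) hv)) hsub.nonneg h4)
  refine ⟨v, hv, h5.symm, ?_⟩
  rw [← h1, mul_assoc, ← h5, h2]

theorem IsFNSTrace.isFinitePos_zero (hτ : A.IsFNSTrace τ) : A.IsFinitePos τ 0 :=
  ⟨zero_mem A, le_rfl, by rw [hτ.map_zero]; exact ENNReal.zero_lt_top⟩

theorem IsFinitePos.add (hτ : A.IsFNSTrace τ) {x y : H →L[ℂ] H} (hx : A.IsFinitePos τ x)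
    (hy : A.IsFinitePos τ y) : A.IsFinitePos τ (x + y) :=
  ⟨add_mem hx.1 hy.1, add_nonneg hx.2.1 hy.2.1, by
    rw [hτ.add _ hx.1 _ hy.1 hx.2.1 hy.2.1]
    exact ENNReal.add_lt_top.2 ⟨hx.2.2, hy.2.2⟩⟩

theorem IsFinitePos.toReal_add (hτ : A.IsFNSTrace τ) {x y : H →L[ℂ] H} (hx : A.IsFinitePos τ x)
    (hy : A.IsFinitePos τ y) : (τ (x + y)).toReal = (τ x).toReal + (τ y).toReal := by
  rw [hτ.add _ hx.1 _ hy.1 hx.2.1 hy.2.1, ENNReal.toReal_add hx.2.2.ne hy.2.2.ne]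

theorem IsFinitePos.smul (hτ : A.IsFNSTrace τ) {x : H →L[ℂ] H} (hx : A.IsFinitePos τ x)
    (r : ℝ≥0) : A.IsFinitePos τ (((r : ℝ) : ℂ) • x) :=
  ⟨A.toStarSubalgebra.smul_mem hx.1 _, by
    rw [Complex.coe_smul]
    exact smul_nonneg r.2 hx.2.1, by
    rw [hτ.smul r x hx.1 hx.2.1]
    exact ENNReal.mul_lt_top ENNReal.coe_lt_top hx.2.2⟩

theorem IsFinitePos.hasTrace (hτ : A.IsFNSTrace τ) {x : H →L[ℂ] H} (hx : A.IsFinitePos τ x) :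
    A.HasTrace τ x ((τ x).toReal : ℂ) :=
  ⟨x, 0, 0, 0, hx, hτ.isFinitePos_zero, hτ.isFinitePos_zero, hτ.isFinitePos_zero, by simp,
    by simp [hτ.map_zero]⟩

theorem HasTrace.zero (hτ : A.IsFNSTrace τ) : A.HasTrace τ 0 0 := by
  simpa [hτ.map_zero] using hτ.isFinitePos_zero.hasTrace hτ

theorem HasTrace.add (hτ : A.IsFNSTrace τ) {x y : H →L[ℂ] H} {s t : ℂ} (hx : A.HasTrace τ x s)
    (hy : A.HasTrace τ y t) : A.HasTrace τ (x + y) (s + t) := by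
  obtain ⟨a, b, c, d, ha, hb, hc, hd, rfl, rfl⟩ := hx
  obtain ⟨a', b', c', d', ha', hb', hc', hd', rfl, rfl⟩ := hy
  refine ⟨_, _, _, _, ha.add hτ ha', hb.add hτ hb', hc.add hτ hc', hd.add hτ hd', by module, ?_⟩
  rw [ha.toReal_add hτ ha', hb.toReal_add hτ hb', hc.toReal_add hτ hc', hd.toReal_add hτ hd']
  push_cast
  ring

theorem HasTrace.real_smul (hτ : A.IsFNSTrace τ) {x : H →L[ℂ] H} {t : ℂ}
    (hx : A.HasTrace τ x t) (r : ℝ) : A.HasTrace τ ((r : ℂ) • x) (r * t) := by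
  have pos : ∀ r : ℝ≥0, A.HasTrace τ (((r : ℝ) : ℂ) • x) ((r : ℝ) * t) := by
    intro r
    obtain ⟨a, b, c, d, ha, hb, hc, hd, rfl, rfl⟩ := hx
    refine ⟨_, _, _, _, ha.smul hτ r, hb.smul hτ r, hc.smul hτ r, hd.smul hτ r, by module, ?_⟩
    rw [hτ.smul r a ha.1 ha.2.1, hτ.smul r b hb.1 hb.2.1, hτ.smul r c hc.1 hc.2.1,
      hτ.smul r d hd.1 hd.2.1]
    simp only [ENNReal.toReal_mul, ENNReal.coe_toReal]
    push_cast
    ring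
  have neg : ∀ {y : H →L[ℂ] H} {s : ℂ}, A.HasTrace τ y s → A.HasTrace τ (-y) (-s) := by
    rintro y s ⟨a, b, c, d, ha, hb, hc, hd, rfl, rfl⟩
    refine ⟨b, a, d, c, hb, ha, hd, hc, by module, ?_⟩
    push_cast
    ring
  rcases le_total 0 r with h | h
  · exact pos ⟨r, h⟩
  · have e : (r : ℂ) = -(((⟨-r, neg_nonneg.2 h⟩ : ℝ≥0) : ℝ) : ℂ) := by
      change (r : ℂ) = -((-r : ℝ) : ℂ)
      rw [Complex.ofReal_neg, neg_neg]
    rw [e, neg_smul, neg_mul]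
    exact neg (pos _)

theorem HasTrace.sum (hτ : A.IsFNSTrace τ) {ι : Type*} (s : Finset ι) {x : ι → H →L[ℂ] H}
    {t : ι → ℂ} (h : ∀ i ∈ s, A.HasTrace τ (x i) (t i)) :
    A.HasTrace τ (∑ i ∈ s, x i) (∑ i ∈ s, t i) := by
  classical
  induction s using Finset.induction_on with
  | empty => simpa using HasTrace.zero hτ
  | insert i s hi ih =>
    rw [Finset.sum_insert hi, Finset.sum_insert hi]
    exact (h i (Finset.mem_insert_self i s)).add hτ
      (ih fun j hj => h j (Finset.mem_insert_of_mem hj))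

/-- A positive element of the definition ideal has finite trace, equal to the value of the linear
extension. -/
theorem HasTrace.eq_of_nonneg (hτ : A.IsFNSTrace τ) {x : H →L[ℂ] H} {t : ℂ}
    (hx : A.HasTrace τ x t) (hx0 : 0 ≤ x) (hxA : x ∈ A) :
    τ x ≠ ∞ ∧ t = ((τ x).toReal : ℂ) := by
  have hfin : A.IsFinitePos τ x := by
    obtain ⟨a, b, c, d, ha, hb, hc, hd, e, -⟩ := hx
    refine ⟨hxA, hx0, ?_⟩
    have sa : ∀ {y : H →L[ℂ] H}, 0 ≤ y → star y = y := fun hy =>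
      (IsSelfAdjoint.of_nonneg hy).star_eq
    have e' := congrArg star e
    simp only [star_add, star_sub, star_smul, sa hx0, sa ha.2.1, sa hb.2.1, sa hc.2.1, sa hd.2.1,
      Complex.star_def, Complex.conj_I] at e'
    have h2 : (2 : ℂ) • (x + b) = (2 : ℂ) • a := by
      rw [two_smul]
      nth_rw 1 [e]
      rw [e']
      module
    have h3 : x + b = a := smul_right_injective _ (two_ne_zero' ℂ) h2
    have h4 := hτ.add x hxA b hb.1 hx0 hb.2.1
    rw [h3] at h4
    exact lt_of_le_of_lt (by rw [h4]; exact le_self_add) ha.2.2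
  exact ⟨hfin.2.2.ne, hx.unique hτ (hfin.hasTrace hτ)⟩

/-- Two projections of finite trace are orthogonal as soon as both of their products have
trace `0`. -/
theorem IsFNSTrace.mul_eq_zero_of_hasTrace (hτ : A.IsFNSTrace τ) {p q : H →L[ℂ] H} (hpA : p ∈ A)
    (hqA : q ∈ A) (hp : IsStarProjection p) (hq : IsStarProjection q) (fp : τ p < ∞)
    (fq : τ q < ∞) (hpq : A.HasTrace τ (p * q) 0) (hqp : A.HasTrace τ (q * p) 0) : p * q = 0 := by
  have sp := hp.isSelfAdjoint.star_eq
  have sq := hq.isSelfAdjoint.star_eq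
  have ip := hp.isIdempotentElem.eq
  have iq := hq.isIdempotentElem.eq
  have e1 : star (q * p) * (q * p) = p * q * p := by
    rw [star_mul, sp, sq, ← mul_assoc, mul_assoc p q q, iq]
  have h0 : 0 ≤ p * q * p := e1 ▸ star_mul_self_nonneg _
  have hA' : p * q * p ∈ A := mul_mem (mul_mem hpA hqA) hpA
  have hle : p * q * p ≤ p := by
    have e2 : star ((1 - q) * p) * ((1 - q) * p) = p - p * q * p := by
      rw [star_mul, sp, hq.one_sub.isSelfAdjoint.star_eq, ← mul_assoc, mul_assoc p (1 - q),
        hq.one_sub.isIdempotentElem.eq, mul_sub, mul_one, sub_mul, ip]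
    exact sub_nonneg.1 (e2 ▸ star_mul_self_nonneg _)
  have fpqp : A.IsFinitePos τ (p * q * p) := ⟨hA', h0, (hτ.mono hA' hpA h0 hle).trans_lt fp⟩
  -- `τ q` is the trace of the conjugate of `q` under the symmetry `2 p - 1`
  have huA : q * (p + p - 1) ∈ A := mul_mem hqA (sub_mem (add_mem hpA hpA) (one_mem A))
  have hu : q * (p + p - 1) * star (q * (p + p - 1)) = q := by
    have : (p + p - 1) * (p + p - 1) = 1 := by
      simp only [sub_mul, mul_sub, add_mul, mul_add, ip, one_mul, mul_one]
      abel
    rw [star_mul, star_sub, star_add, sp, sq, star_one, mul_assoc, ← mul_assoc (p + p - 1), this,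
      one_mul, iq]
  have hu' : star (q * (p + p - 1)) * (q * (p + p - 1)) =
      q + ((-2 : ℝ) : ℂ) • (p * q) + ((-2 : ℝ) : ℂ) • (q * p) + ((4 : ℝ) : ℂ) • (p * q * p) := by
    rw [star_mul, star_sub, star_add, sp, sq, star_one, ← mul_assoc, mul_assoc _ q q, iq]
    simp only [sub_mul, mul_sub, add_mul, mul_add, one_mul, mul_one]
    push_cast
    module
  have ht := hτ.tracial _ huA
  rw [hu] at ht
  have hT := IsFinitePos.hasTrace hτ (x := star (q * (p + p - 1)) * (q * (p + p - 1)))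
    ⟨mul_mem (star_mem huA) huA, star_mul_self_nonneg _, by rw [ht]; exact fq⟩
  rw [ht, hu'] at hT
  have hT' := (((IsFinitePos.hasTrace hτ ⟨hqA, hq.nonneg, fq⟩).add hτ
    (hpq.real_smul hτ (-2))).add hτ (hqp.real_smul hτ (-2))).add hτ
    ((fpqp.hasTrace hτ).real_smul hτ 4)
  have h1 := hT.unique hτ hT'
  push_cast at h1
  have h2 : (τ (p * q * p)).toReal = 0 := by
    have : ((τ (p * q * p)).toReal : ℂ) = 0 := by linear_combination (-1 / 4 : ℂ) * h1
    exact_mod_cast this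
  have h3 : τ (p * q * p) = 0 := (ENNReal.toReal_eq_zero_iff _).1 h2 |>.resolve_right fpqp.2.2.ne
  have h4 := hτ.faithful _ hA' h0 h3
  rw [← e1] at h4
  have h5 := congrArg star (CStarRing.star_mul_self_eq_zero_iff _ |>.1 h4)
  rwa [star_mul, sp, sq, star_zero] at h5

/-! ### Maps preserving transition probabilities -/

variable {c : ℝ≥0∞} {φ : A.Grassmann τ c → A.Grassmann τ c}

theorem Grassmann.hasTrace_traceExt (hτ : A.IsFNSTrace τ) (hc : c < ∞) (P Q : A.Grassmann τ c) :
    A.HasTrace τ ((P : H →L[ℂ] H) * (Q : H →L[ℂ] H))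
      (A.traceExt τ ((P : H →L[ℂ] H) * (Q : H →L[ℂ] H))) := by
  obtain ⟨t, ht⟩ := hasTrace_mul hτ P.2.1 Q.2.1 P.2.2.1 Q.2.2.1
    (P.2.2.2.trans_lt hc) (Q.2.2.2.trans_lt hc)
  rwa [ht.traceExt_eq hτ]

/-- The value of the extended trace at the square of a real linear combination depends only on
the transition probabilities. -/
theorem Grassmann.hasTrace_sum_sq (hτ : A.IsFNSTrace τ) (hc : c < ∞) {ι : Type*} (s : Finset ι)
    (r : ι → ℝ) (P : ι → A.Grassmann τ c) :
    A.HasTrace τ ((∑ i ∈ s, (r i : ℂ) • (P i : H →L[ℂ] H)) *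
        ∑ i ∈ s, (r i : ℂ) • (P i : H →L[ℂ] H))
      (∑ i ∈ s, ∑ j ∈ s, ((r i * r j : ℝ) : ℂ) *
        A.traceExt τ ((P i : H →L[ℂ] H) * (P j : H →L[ℂ] H))) := by
  have h : (∑ i ∈ s, (r i : ℂ) • (P i : H →L[ℂ] H)) * ∑ i ∈ s, (r i : ℂ) • (P i : H →L[ℂ] H) =
      ∑ i ∈ s, ∑ j ∈ s, ((r i * r j : ℝ) : ℂ) • ((P i : H →L[ℂ] H) * (P j : H →L[ℂ] H)) := by
    rw [Finset.sum_mul_sum]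
    refine Finset.sum_congr rfl fun i _ => Finset.sum_congr rfl fun j _ => ?_
    rw [smul_mul_smul_comm, Complex.ofReal_mul]
  rw [h]
  exact .sum hτ s fun i _ => .sum hτ s fun j _ => (hasTrace_traceExt hτ hc _ _).real_smul hτ _

namespace PreservesTransitionProbability

/-- Linear relations are preserved, because `φ` preserves the `L²`-norm of real linear
combinations of projections and the trace is faithful. -/
theorem sum_smul_eq_zero (hφ : A.PreservesTransitionProbability τ φ) (hτ : A.IsFNSTrace τ)
    (hc : c < ∞) {ι : Type*} (s : Finset ι) (r : ι → ℝ) (P : ι → A.Grassmann τ c)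
    (h : ∑ i ∈ s, (r i : ℂ) • (P i : H →L[ℂ] H) = 0) :
    ∑ i ∈ s, (r i : ℂ) • (φ (P i) : H →L[ℂ] H) = 0 := by
  set X : H →L[ℂ] H := ∑ i ∈ s, (r i : ℂ) • (φ (P i) : H →L[ℂ] H) with hX
  have h1 := Grassmann.hasTrace_sum_sq hτ hc s r P
  have h2 := Grassmann.hasTrace_sum_sq hτ hc s r fun i => φ (P i)
  rw [h, zero_mul] at h1
  simp only [hφ _ _] at h2
  rw [← (HasTrace.zero hτ).unique hτ h1, ← hX] at h2
  have hXs : star X = X := by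
    simp only [hX, star_sum, star_smul, (φ _).2.2.1.isSelfAdjoint.star_eq, Complex.star_def,
      Complex.conj_ofReal]
  have hXA : X ∈ A := sum_mem fun i _ => A.toStarSubalgebra.smul_mem (φ (P i)).2.1 _
  have hX0 : 0 ≤ X * X := by
    have := star_mul_self_nonneg X
    rwa [hXs] at this
  obtain ⟨h3, h4⟩ := h2.eq_of_nonneg hτ hX0 (mul_mem hXA hXA)
  have h5 : τ (X * X) = 0 :=
    (ENNReal.toReal_eq_zero_iff _).1 (by exact_mod_cast h4.symm) |>.resolve_right h3
  have h6 := hτ.faithful _ (mul_mem hXA hXA) hX0 h5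
  nth_rw 1 [← hXs] at h6
  exact CStarRing.star_mul_self_eq_zero_iff _ |>.1 h6

theorem sub_eq_sub (hφ : A.PreservesTransitionProbability τ φ) (hτ : A.IsFNSTrace τ)
    (hc : c < ∞) {P Q R S : A.Grassmann τ c} (h : (P - Q : H →L[ℂ] H) = R - S) :
    (φ P - φ Q : H →L[ℂ] H) = φ R - φ S := by
  have := hφ.sum_smul_eq_zero hτ hc Finset.univ ![1, -1, -1, 1] ![P, Q, R, S] (by
    simp only [Fin.sum_univ_four, Matrix.cons_val, Complex.ofReal_one, Complex.ofReal_neg,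
      one_smul, neg_smul]
    rw [← sub_eq_zero.2 h]
    abel)
  simp only [Fin.sum_univ_four, Matrix.cons_val, Complex.ofReal_one, Complex.ofReal_neg,
    one_smul, neg_smul] at this
  rw [← sub_eq_zero, ← this]
  abel

theorem mul_eq_zero (hφ : A.PreservesTransitionProbability τ φ) (hτ : A.IsFNSTrace τ)
    (hc : c < ∞) {P Q : A.Grassmann τ c} (h : (P : H →L[ℂ] H) * Q = 0) :
    (φ P : H →L[ℂ] H) * φ Q = 0 := by
  have h' : (Q : H →L[ℂ] H) * P = 0 := by
    have := congrArg star h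
    rwa [star_mul, P.2.2.1.isSelfAdjoint.star_eq, Q.2.2.1.isSelfAdjoint.star_eq, star_zero] at this
  have key : ∀ R S : A.Grassmann τ c, (R : H →L[ℂ] H) * S = 0 →
      A.HasTrace τ ((φ R : H →L[ℂ] H) * φ S) 0 := fun R S hRS => by
    have := Grassmann.hasTrace_traceExt hτ hc (φ R) (φ S)
    rwa [hφ R S, hRS, (HasTrace.zero hτ).traceExt_eq hτ] at this
  exact hτ.mul_eq_zero_of_hasTrace (φ P).2.1 (φ Q).2.1 (φ P).2.2.1 (φ Q).2.2.1
    ((φ P).2.2.2.trans_lt hc) ((φ Q).2.2.2.trans_lt hc) (key P Q h) (key Q P h')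

theorem sub_mul_eq_zero (hφ : A.PreservesTransitionProbability τ φ) (hτ : A.IsFNSTrace τ)
    (hc : c < ∞) {P Q R S T : A.Grassmann τ c} (h : (P - Q : H →L[ℂ] H) = R - S)
    (hR : (R : H →L[ℂ] H) * T = 0) (hS : (S : H →L[ℂ] H) * T = 0) :
    (φ P : H →L[ℂ] H) * φ T = (φ Q : H →L[ℂ] H) * φ T := by
  rw [← sub_eq_zero, ← sub_mul, hφ.sub_eq_sub hτ hc h, sub_mul, hφ.mul_eq_zero hτ hc hR,
    hφ.mul_eq_zero hτ hc hS, sub_zero]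

/-- Three projections `e + g`, `f + g`, `k + g` with a common part `g`, together with a second
common part `g'` orthogonal to everything else, have commuting images: with `p`, `q`, `t` the
images, replacing `g` by `g'` shows `(p - q) t = 0` and its permutations, so
`p q = t q = t p = q p`. -/
theorem commute_of_orthogonal (hφ : A.PreservesTransitionProbability τ φ) (hτ : A.IsFNSTrace τ)
    (hc : c < ∞) {e f k g g' : H →L[ℂ] H} {P Q T U V W : A.Grassmann τ c}
    (hP : (P : H →L[ℂ] H) = e + g) (hQ : (Q : H →L[ℂ] H) = f + g) (hT : (T : H →L[ℂ] H) = k + g)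
    (hU : (U : H →L[ℂ] H) = e + g') (hV : (V : H →L[ℂ] H) = f + g')
    (hW : (W : H →L[ℂ] H) = k + g')
    (hUT : (U : H →L[ℂ] H) * T = 0) (hVT : (V : H →L[ℂ] H) * T = 0)
    (hUQ : (U : H →L[ℂ] H) * Q = 0) (hWQ : (W : H →L[ℂ] H) * Q = 0)
    (hVP : (V : H →L[ℂ] H) * P = 0) (hWP : (W : H →L[ℂ] H) * P = 0) :
    Commute (φ P : H →L[ℂ] H) (φ Q : H →L[ℂ] H) := by
  have hPQT := hφ.sub_mul_eq_zero hτ hc (P := P) (Q := Q) (R := U) (S := V) (T := T)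
    (by rw [hP, hQ, hU, hV]; abel) hUT hVT
  have hPTQ := hφ.sub_mul_eq_zero hτ hc (P := P) (Q := T) (R := U) (S := W) (T := Q)
    (by rw [hP, hT, hU, hW]; abel) hUQ hWQ
  have hQTP := hφ.sub_mul_eq_zero hτ hc (P := Q) (Q := T) (R := V) (S := W) (T := P)
    (by rw [hQ, hT, hV, hW]; abel) hVP hWP
  have h := congrArg star hPQT
  simp only [star_mul, (φ _).2.2.1.isSelfAdjoint.star_eq] at h
  exact hPTQ.trans (h.symm.trans hQTP.symm)

end PreservesTransitionProbability

/-- Exchanging a subprojection of an element of the Grassmann space for an orthogonal projection of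
the same trace. -/
theorem Grassmann.exchange_mem (hτ : A.IsFNSTrace τ) {p e f : H →L[ℂ] H}
    (hp : p ∈ A.Grassmann τ c) (heA : e ∈ A) (hfA : f ∈ A) (he : IsStarProjection e)
    (hf : IsStarProjection f) (hpe : p * e = e) (hpf : p * f = 0) (hef : τ e = τ f) :
    p - e + f ∈ A.Grassmann τ c := by
  obtain ⟨hpA, hpP, hpc⟩ := hp
  have hsub := he.sub_of_mul_eq_right hpP hpe
  have hef0 : e * f = 0 := by
    have h := congrArg star hpe
    rw [star_mul, he.isSelfAdjoint.star_eq, hpP.isSelfAdjoint.star_eq] at h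
    rw [← h, mul_assoc, hpf, mul_zero]
  refine ⟨add_mem (sub_mem hpA heA) hfA, hsub.add hf (by rw [sub_mul, hpf, hef0, sub_zero]), ?_⟩
  rw [hτ.add _ (sub_mem hpA heA) _ hfA hsub.nonneg hf.nonneg, ← hef,
    hτ.sub_add hpA heA he.nonneg hsub.nonneg, hpc]

/-! ### Commuting projections in a factor -/

theorem IsFNSTrace.map_conj (hτ : A.IsFNSTrace τ) {p e v : H →L[ℂ] H} (heA : e ∈ A) (hvA : v ∈ A)
    (he : IsStarProjection e) (hv : star v * v = p) (hpe : p * e = e) :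
    τ (v * e * star v) = τ e := by
  have h := hτ.tracial (v * e) (mul_mem hvA heA)
  have h1 : star (v * e) * (v * e) = e := by
    rw [star_mul, he.isSelfAdjoint.star_eq, mul_assoc, ← mul_assoc (star v), hv, hpe,
      he.isIdempotentElem.eq]
  have h2 : v * e * star (v * e) = v * e * star v := by
    rw [star_mul, he.isSelfAdjoint.star_eq, ← mul_assoc, mul_assoc v e e,
      he.isIdempotentElem.eq]
  rw [h1, h2] at h
  exact h.symm

/-- The images of `p` and `p - e + f` commute when `e` and `f` are so small that a copy of `p`
fits into the complement of `p + f`. -/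
theorem PreservesTransitionProbability.commute_exchange_of_small
    (hφ : A.PreservesTransitionProbability τ φ) (hτ : A.IsFNSTrace τ) (hA : A.IsFactor)
    (hc : c < ∞) {e f : H →L[ℂ] H} {P Q : A.Grassmann τ c} (heA : e ∈ A) (hfA : f ∈ A)
    (he : IsStarProjection e) (hf : IsStarProjection f) (hPe : (P : H →L[ℂ] H) * e = e)
    (hPf : (P : H →L[ℂ] H) * f = 0) (hef : τ e = τ f) (hsmall : c + c + τ e ≤ τ 1)
    (hQ : (Q : H →L[ℂ] H) = P - e + f) :
    Commute (φ P : H →L[ℂ] H) (φ Q : H →L[ℂ] H) := by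
  obtain ⟨p, hPm⟩ := P
  obtain ⟨q, hQm⟩ := Q
  simp only at hPe hPf hQ
  have hpA := hPm.1
  have hp := hPm.2.1
  have hpc : τ p = c := hPm.2.2
  have hfP := mul_eq_zero_of_isStarProjection hp hf hPf
  have hfe : f * e = 0 := by rw [← hPe, ← mul_assoc, hfP, zero_mul]
  have hg := he.sub_of_mul_eq_right hp hPe
  have hpf := hp.add hf hPf
  have hr : IsStarProjection (1 - (p + f)) := hpf.one_sub
  have hrA : 1 - (p + f) ∈ A := sub_mem (one_mem A) (add_mem hpA hfA)
  have hfin_e : τ e ≠ ∞ := by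
    have := hτ.sub_add hpA heA he.nonneg hg.nonneg
    rw [hpc] at this
    exact fun h => hc.ne (by rw [← this, h, add_top])
  have hle : τ p ≤ τ (1 - (p + f)) := by
    have h1 := hτ.sub_add (one_mem A) (add_mem hpA hfA) hpf.nonneg hr.nonneg
    rw [hτ.add _ hpA _ hfA hp.nonneg hf.nonneg, hpc, ← hef] at h1
    rw [← h1, add_assoc] at hsmall
    rw [hpc]
    exact (ENNReal.add_le_add_iff_right (ENNReal.add_lt_top.2 ⟨hc, hfin_e.lt_top⟩).ne).1 hsmall
  obtain ⟨v, hvA, hv, hrv⟩ :=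
    hτ.exists_partialIsometry hA hpA hrA hp hr (hpc ▸ hc.ne) hle
  have hpv : p * v = 0 := by
    have : p * (1 - (p + f)) = 0 := by
      rw [mul_sub, mul_add, hp.isIdempotentElem.eq, hPf, mul_one, add_zero, sub_self]
    rw [← hrv, ← mul_assoc, this, zero_mul]
  have hfv : f * v = 0 := by
    have : f * (1 - (p + f)) = 0 := by
      rw [mul_sub, mul_add, hf.isIdempotentElem.eq, hfP, mul_one, zero_add, sub_self]
    rw [← hrv, ← mul_assoc, this, zero_mul]
  have hvp : star v * p = 0 := by
    simpa only [star_mul, hp.isSelfAdjoint.star_eq, star_zero] using congrArg star hpv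
  have hvf : star v * f = 0 := by
    simpa only [star_mul, hf.isSelfAdjoint.star_eq, star_zero] using congrArg star hfv
  have hve : star v * e = 0 := by rw [← hPe, ← mul_assoc, hvp, zero_mul]
  have hpg : p * (p - e) = p - e := by rw [mul_sub, hPe, hp.isIdempotentElem.eq]
  have hge : (p - e) * e = 0 := by rw [sub_mul, hPe, he.isIdempotentElem.eq, sub_self]
  have heg : e * (p - e) = 0 := mul_eq_zero_of_isStarProjection hg he hge
  have hfg : f * (p - e) = 0 := by rw [mul_sub, hfP, hfe, sub_zero]
  have hef0 : e * f = 0 := mul_eq_zero_of_isStarProjection hf he hfe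
  -- the copies of `e` and `p - e` in the complement of `p + f`
  set k := v * e * star v with hk
  set g' := v * (p - e) * star v with hg'
  have hkP : IsStarProjection k := isStarProjection_conj he hv hPe
  have hg'P : IsStarProjection g' := isStarProjection_conj hg hv hpg
  have hkA : k ∈ A := mul_mem (mul_mem hvA heA) (star_mem hvA)
  have hg'A : g' ∈ A := mul_mem (mul_mem hvA (sub_mem hpA heA)) (star_mem hvA)
  have hkτ : τ k = τ e := hτ.map_conj heA hvA he hv hPe
  have hg'τ : τ g' = τ (p - e) := hτ.map_conj (sub_mem hpA heA) hvA hg hv hpg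
  have hpk : p * k = 0 := by rw [hk, ← mul_assoc, ← mul_assoc, hpv, zero_mul, zero_mul]
  have hg'p : g' * p = 0 := by rw [hg', mul_assoc, hvp, mul_zero]
  have hg'e : g' * e = 0 := by rw [hg', mul_assoc, hve, mul_zero]
  have hg'f : g' * f = 0 := by rw [hg', mul_assoc, hvf, mul_zero]
  have hkp : k * p = 0 := by rw [hk, mul_assoc, hvp, mul_zero]
  have hke : k * e = 0 := by rw [hk, mul_assoc, hve, mul_zero]
  have hkf : k * f = 0 := by rw [hk, mul_assoc, hvf, mul_zero]
  have hek : e * k = 0 := mul_eq_zero_of_isStarProjection hkP he hke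
  have hfk : f * k = 0 := mul_eq_zero_of_isStarProjection hkP hf hkf
  have hg'k : g' * k = 0 := by
    have : g' * k = v * ((p - e) * (star v * v * e)) * star v := by
      rw [hg', hk]; noncomm_ring
    rw [this, hv, hPe, hge, mul_zero, zero_mul]
  have hkg' : k * g' = 0 := mul_eq_zero_of_isStarProjection hg'P hkP hg'k
  have heg' : e * g' = 0 := mul_eq_zero_of_isStarProjection hg'P he hg'e
  have hfg' : f * g' = 0 := mul_eq_zero_of_isStarProjection hg'P hf hg'f
  have hg'g : g' * (p - e) = 0 := by rw [mul_sub, hg'p, hg'e, sub_zero]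
  have hkg : k * (p - e) = 0 := by rw [mul_sub, hkp, hke, sub_zero]
  have mem : ∀ x ∈ A, IsStarProjection x → τ x = τ e → x * g' = 0 → x + g' ∈ A.Grassmann τ c := by
    intro x hxA hx hxe hxg
    refine ⟨add_mem hxA hg'A, hx.add hg'P hxg, ?_⟩
    rw [hτ.add _ hxA _ hg'A hx.nonneg hg'P.nonneg, hxe, hg'τ, add_comm,
      hτ.sub_add hpA heA he.nonneg hg.nonneg, hpc]
  have hT : k + (p - e) ∈ A.Grassmann τ c := by
    rw [add_comm]
    exact Grassmann.exchange_mem hτ hPm heA hkA he hkP hPe hpk hkτ.symm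
  refine hφ.commute_of_orthogonal hτ hc (e := e) (f := f) (k := k) (g := p - e) (g' := g')
    (T := ⟨k + (p - e), hT⟩) (U := ⟨e + g', mem e heA he rfl heg'⟩)
    (V := ⟨f + g', mem f hfA hf hef.symm hfg'⟩) (W := ⟨k + g', mem k hkA hkP hkτ hkg'⟩)
    (add_sub_cancel e p).symm (hQ.trans (add_comm _ _)) rfl rfl rfl rfl ?_ ?_ ?_ ?_ ?_ ?_
  · simp only [add_mul, mul_add, hek, heg, hg'k, hg'g, add_zero]
  · simp only [add_mul, mul_add, hfk, hfg, hg'k, hg'g, add_zero]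
  · simp only [hQ, add_mul, mul_add, heg, hef0, hg'g, hg'f, add_zero]
  · simp only [hQ, add_mul, mul_add, hkg, hkf, hg'g, hg'f, add_zero]
  · simp only [add_mul, hfP, hg'p, add_zero]
  · simp only [add_mul, hkp, hg'p, add_zero]

/-- A projection with at least the trace of `w` splits off a subprojection equivalent to `w`. -/
theorem IsFNSTrace.exists_subprojection (hτ : A.IsFNSTrace τ) (hA : A.IsFactor)
    {w e : H →L[ℂ] H} (hwA : w ∈ A) (heA : e ∈ A) (hw : IsStarProjection w)
    (he : IsStarProjection e) (hfin : τ w ≠ ∞) (hle : τ w ≤ τ e) :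
    ∃ e₁ ∈ A, IsStarProjection e₁ ∧ e * e₁ = e₁ ∧ τ e₁ = τ w := by
  obtain ⟨v, hvA, hv, hev⟩ := hτ.exists_partialIsometry hA hwA heA hw he hfin hle
  refine ⟨v * star v, mul_mem hvA (star_mem hvA), isStarProjection_mul_star hw hv, ?_, ?_⟩
  · rw [← mul_assoc, hev]
  · rw [← hτ.tracial v hvA, hv]

/-- The images of `p` and `p - e + f` commute, by induction on the number of copies of a small
projection `w` that are needed to exhaust `e` and `f`. -/
theorem PreservesTransitionProbability.commute_exchange
    (hφ : A.PreservesTransitionProbability τ φ) (hτ : A.IsFNSTrace τ) (hA : A.IsFactor)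
    (hc : c < ∞) {w : H →L[ℂ] H} (hwA : w ∈ A) (hw : IsStarProjection w)
    (hwτ : c + c + τ w = τ 1) (n : ℕ) :
    ∀ {e f : H →L[ℂ] H} {P Q : A.Grassmann τ c}, e ∈ A → f ∈ A → IsStarProjection e →
      IsStarProjection f → (P : H →L[ℂ] H) * e = e → (P : H →L[ℂ] H) * f = 0 → τ e = τ f →
      τ e ≤ n * τ w → (Q : H →L[ℂ] H) = P - e + f →
      Commute (φ P : H →L[ℂ] H) (φ Q : H →L[ℂ] H) := by
  induction n with
  | zero =>
    intro e f P Q heA hfA he hf hPe hPf hef hn hQ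
    refine hφ.commute_exchange_of_small hτ hA hc heA hfA he hf hPe hPf hef ?_ hQ
    rw [← hwτ]
    gcongr
    exact hn.trans (by simp)
  | succ n ih =>
    intro e f P Q heA hfA he hf hPe hPf hef hn hQ
    rcases le_total (τ e) (τ w) with hew | hwe
    · exact hφ.commute_exchange_of_small hτ hA hc heA hfA he hf hPe hPf hef
        (by rw [← hwτ]; gcongr) hQ
    have hg := he.sub_of_mul_eq_right P.2.2.1 hPe
    have hfin_e : τ e ≠ ∞ := by
      have := hτ.sub_add P.2.1 heA he.nonneg hg.nonneg
      rw [P.2.2.2] at this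
      exact fun h => hc.ne (by rw [← this, h, add_top])
    have hfin_w : τ w ≠ ∞ := (hwe.trans_lt hfin_e.lt_top).ne
    obtain ⟨e₁, he₁A, he₁, hee₁, hτe₁⟩ := hτ.exists_subprojection hA hwA heA hw he hfin_w hwe
    obtain ⟨f₁, hf₁A, hf₁, hff₁, hτf₁⟩ :=
      hτ.exists_subprojection hA hwA hfA hw hf hfin_w (hef ▸ hwe)
    have he₂ := he₁.sub_of_mul_eq_right he hee₁
    have hf₂ := hf₁.sub_of_mul_eq_right hf hff₁
    have hPe₁ : (P : H →L[ℂ] H) * e₁ = e₁ := by rw [← hee₁, ← mul_assoc, hPe]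
    have hPf₁ : (P : H →L[ℂ] H) * f₁ = 0 := by rw [← hff₁, ← mul_assoc, hPf, zero_mul]
    have hPe₂ : (P : H →L[ℂ] H) * (e - e₁) = e - e₁ := by rw [mul_sub, hPe, hPe₁]
    have hPf₂ : (P : H →L[ℂ] H) * (f - f₁) = 0 := by rw [mul_sub, hPf, hPf₁, sub_zero]
    have hτ₁ : τ e₁ = τ f₁ := hτe₁.trans hτf₁.symm
    have hse := hτ.sub_add heA he₁A he₁.nonneg he₂.nonneg
    have hsf := hτ.sub_add hfA hf₁A hf₁.nonneg hf₂.nonneg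
    rw [hτe₁] at hse
    rw [hτf₁, ← hef, ← hse] at hsf
    have hτ₂ : τ (e - e₁) = τ (f - f₁) := ((ENNReal.add_left_inj hfin_w).1 hsf).symm
    have hn₂ : τ (e - e₁) ≤ n * τ w := by
      refine (ENNReal.add_le_add_iff_right hfin_w).1 ?_
      rw [hse]
      exact hn.trans_eq (by push_cast; ring)
    let P' : A.Grassmann τ c :=
      ⟨_, Grassmann.exchange_mem hτ P.2 he₁A hf₁A he₁ hf₁ hPe₁ hPf₁ hτ₁⟩
    let Q' : A.Grassmann τ c :=
      ⟨_, Grassmann.exchange_mem hτ P.2 (sub_mem heA he₁A) (sub_mem hfA hf₁A) he₂ hf₂ hPe₂ hPf₂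
        hτ₂⟩
    have h1 : Commute (φ P : H →L[ℂ] H) (φ P' : H →L[ℂ] H) :=
      hφ.commute_exchange_of_small hτ hA hc he₁A hf₁A he₁ hf₁ hPe₁ hPf₁ hτ₁
        (by rw [hτe₁, hwτ]) rfl
    have h2 : Commute (φ P : H →L[ℂ] H) (φ Q' : H →L[ℂ] H) :=
      ih (sub_mem heA he₁A) (sub_mem hfA hf₁A) he₂ hf₂ hPe₂ hPf₂ hτ₂ hn₂ rfl
    have h3 : (φ P - φ P' : H →L[ℂ] H) = φ Q' - φ Q := by
      refine hφ.sub_eq_sub hτ hc ?_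
      change (P : H →L[ℂ] H) - (P - e₁ + f₁) = P - (e - e₁) + (f - f₁) - Q
      rw [hQ]
      abel
    have h4 : (φ Q : H →L[ℂ] H) = φ Q' - (φ P - φ P') := by rw [h3]; abel
    rw [h4]
    exact h2.sub_right ((Commute.refl _).sub_right h1)

end VonNeumannAlgebra

end FactorPreservers

theorem mainTheorem3 {H : Type*} [NormedAddCommGroup H] [InnerProductSpace ℂ H] [CompleteSpace H]
    (A : VonNeumannAlgebra H) (hA : A.IsFactor) (hA2 : ¬ A.IsTypeITwo)
    (τ : (H →L[ℂ] H) → ℝ≥0∞) (hτ : A.IsFNSTrace τ)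
    (c : ℝ≥0∞) (hc0 : 0 < c) (hc : c < τ 1 / 2)
    (φ : A.Grassmann τ c → A.Grassmann τ c)
    (hφ : A.PreservesTransitionProbability τ φ)
    (P Q : A.Grassmann τ c) (hPQ : Commute (P : H →L[ℂ] H) (Q : H →L[ℂ] H)) :
    Commute (φ P : H →L[ℂ] H) (φ Q : H →L[ℂ] H) := by
  have hcfin : c < ∞ := lt_of_lt_of_le hc le_top
  have h2c : c + c < τ 1 := by
    rw [← mul_two]
    exact (ENNReal.lt_div_iff_mul_lt (by simp) (by simp)).1 hc
  obtain ⟨p, hpA, hp, hpc⟩ := P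
  obtain ⟨q, hqA, hq, hqc⟩ := Q
  simp only at hPQ
  -- the complement of `p` and a copy `r` of `p` orthogonal to it is a non-zero projection `w`
  have hsp := hτ.sub_add (one_mem A) hpA hp.nonneg hp.one_sub.nonneg
  rw [hpc] at hsp
  have hle : τ p ≤ τ (1 - p) := by
    rw [hpc]
    exact (ENNReal.add_le_add_iff_right hcfin.ne).1 (hsp ▸ h2c.le)
  obtain ⟨r, hrA, hr, hpr, hτr⟩ := hτ.exists_subprojection hA hpA (sub_mem (one_mem A) hpA) hp
    hp.one_sub (hpc ▸ hcfin.ne) hle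
  have hw := hr.sub_of_mul_eq_right hp.one_sub hpr
  have hwA : 1 - p - r ∈ A := sub_mem (sub_mem (one_mem A) hpA) hrA
  have hsr := hτ.sub_add (sub_mem (one_mem A) hpA) hrA hr.nonneg hw.nonneg
  have hwτ : c + c + τ (1 - p - r) = τ 1 := by
    rw [← hsp, ← hsr, hτr, hpc]
    ring
  have hw0 : τ (1 - p - r) ≠ 0 := fun h => by
    rw [h, add_zero] at hwτ
    exact h2c.ne hwτ
  have hpq : IsStarProjection (p * q) := hp.mul hq hPQ
  have hpqA : p * q ∈ A := mul_mem hpA hqA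
  have hppq : p * (p * q) = p * q := by rw [← mul_assoc, hp.isIdempotentElem.eq]
  have hqpq : q * (p * q) = p * q := by rw [hPQ.eq, ← mul_assoc, hq.isIdempotentElem.eq]
  have he := hpq.sub_of_mul_eq_right hp hppq
  have hf := hpq.sub_of_mul_eq_right hq hqpq
  have hse := hτ.sub_add hpA hpqA hpq.nonneg he.nonneg
  have hsf := hτ.sub_add hqA hpqA hpq.nonneg hf.nonneg
  rw [hpc] at hse
  rw [hqc] at hsf
  have hfin : τ (p * q) ≠ ∞ := fun h => hcfin.ne (by rw [← hse, h, add_top])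
  have hfin' : τ (p - p * q) ≠ ∞ := fun h => hcfin.ne (by rw [← hse, h, top_add])
  obtain ⟨n, hn⟩ := ENNReal.exists_nat_mul_gt hw0 hfin'
  exact hφ.commute_exchange hτ hA hcfin hwA hw hwτ n (e := p - p * q) (f := q - p * q)
    (sub_mem hpA hpqA) (sub_mem hqA hpqA) he hf
    (by rw [mul_sub, hppq, hp.isIdempotentElem.eq]) (by rw [mul_sub, hppq, sub_self])
    ((ENNReal.add_left_inj hfin).1 (hse.trans hsf.symm)) hn.le (by simp only; abel)
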